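/- Let $K$ be an algebraically closed field, $X$ a finite set of variables, $H\subseteq K[X]$ an ideal, $T\in K[X]$ a polynomial, and $U\subseteq X$ a set of variables that is independent for $H$, i.e. $H\cap K[U]=(0)$. Let $z$ be a new variable, put $I=(H,\,Tz-1)\subseteq K[U][X\setminus U,z]$, and fix a monomial order on the variables $X\setminus U,z$. A *reduced Gröbner system* of $I$ with parameters $U$ is a finite family of pairs $(S_i,B_i)$, $1\le i\le s$, where the segments $S_i$ are nonempty constructible sets that partition the parameter space $K^U$, and each $B_i\subset K[U][X\setminus U,z]$ is a finite set of polynomials of content $1$ over $K[U]$ with pairwise distinct leading monomials, such that for every $u_0\in S_i$ the leading coefficients of the elements of $B_i$ do not vanish at $u_0$ and the elements of $B_i$, specialized at $u_0$ and made monic, form the reduced Gröbner basis of the specialization of $I$ at $u_0$. A *minimal comprehensive Gröbner system* (MCCGS) of $\{H,Tz-1\}$ with respect to $U$ is a reduced Gröbner system with the least possible number of segments. Its *generic segment* is the segment that contains a nonempty Zariski-open subset of $K^U$. A basis is said to be $1$ if it consists of a single nonzero constant (content-$1$ polynomials being determined only up to a nonzero constant factor). Then: 1. $T$ vanishes identically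 on every irreducible component $C$ of $\mathbb V(H)\subseteq K^X$ on which $U$ remains independent (i.e. no nonzero element of $K[U]$ vanishes identically on $C$) if and only if $I\cap K[U]\neq(0)$. 2. Every MCCGS of $\{H,Tz-1\}$ with respect to $U$ has exactly one generic segment, and $T$ vanishes identically on every irreducible component of $\mathbb V(H)$ on which $U$ remains independent if and only if the basis of the generic segment is $1$. -/

import Mathlib

open MvPolynomial

namespace MCCGS

/-! ### Affine algebraic sets -/

section Geometry

variable {σ K : Type*} [Field K]

/-- An algebraic subset of the affine space `K^σ`. -/
def IsAlgebraicSet (C : Set (σ → K)) : Prop :=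
  ∃ I : Ideal (MvPolynomial σ K), C = zeroLocus K I

/-- A nonempty algebraic set that is not covered by two algebraic sets unless one of them
already covers it. -/
structure IsIrreducibleAlgebraicSet (C : Set (σ → K)) : Prop where
  isAlgebraicSet : IsAlgebraicSet C
  nonempty : C.Nonempty
  subset_or_subset : ∀ I J : Ideal (MvPolynomial σ K),
    C ⊆ zeroLocus K I ∪ zeroLocus K J → C ⊆ zeroLocus K I ∨ C ⊆ zeroLocus K J

/-- `C` is an irreducible component of the algebraic set `V`. -/
def IsComponent (V C : Set (σ → K)) : Prop :=
  Maximal (fun D => IsIrreducibleAlgebraicSet D ∧ D ⊆ V) C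

/-- A constructible subset of `K^σ`: a finite union of differences of algebraic sets. -/
def IsConstructibleSet (S : Set (σ → K)) : Prop :=
  ∃ (n : ℕ) (a b : Fin n → Ideal (MvPolynomial σ K)),
    S = ⋃ j, zeroLocus K (a j) \ zeroLocus K (b j)

/-- `S` contains a nonempty Zariski-open subset of `K^σ`. -/
def ContainsOpen (S : Set (σ → K)) : Prop :=
  ∃ J : Ideal (MvPolynomial σ K), (zeroLocus K J)ᶜ.Nonempty ∧ (zeroLocus K J)ᶜ ⊆ S

/-- The variables in `U` are independent for the ideal `I`: `I ∩ K[U] = (0)`. -/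
def IndependentVars (U : Set σ) (I : Ideal (MvPolynomial σ K)) : Prop :=
  I.comap (rename ((↑) : U → σ) : MvPolynomial U K →ₐ[K] MvPolynomial σ K) = ⊥

/-- `T` vanishes identically on every irreducible component of `V(H)` on which the
variables `U` remain independent. -/
def VanishesOnIndependentComponents (U : Set σ) (H : Ideal (MvPolynomial σ K))
    (T : MvPolynomial σ K) : Prop :=
  ∀ C : Set (σ → K), IsComponent (zeroLocus K H) C →
    IndependentVars U (vanishingIdeal K C) → ∀ x ∈ C, eval x T = 0

end Geometry

/-! ### Gröbner bases over a field -/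

section Groebner

variable {ξ K : Type*} [Field K]

/-- `B` is a Gröbner basis of `I`: the leading monomial of every nonzero element of `I`
is divisible by that of a nonzero element of `B`. -/
def IsGroebnerBasis (m : MonomialOrder ξ) (I : Ideal (MvPolynomial ξ K))
    (B : Set (MvPolynomial ξ K)) : Prop :=
  B ⊆ I ∧ ∀ f ∈ I, f ≠ 0 → ∃ b ∈ B, b ≠ 0 ∧ m.degree b ≤ m.degree f

/-- `B` is the reduced Gröbner basis of `I`: its elements are monic, and no monomial of an
element is divisible by the leading monomial of another element. -/
structure IsReducedGroebnerBasis (m : MonomialOrder ξ) (I : Ideal (MvPolynomial ξ K))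
    (B : Set (MvPolynomial ξ K)) : Prop where
  isGroebnerBasis : IsGroebnerBasis m I B
  monic : ∀ b ∈ B, m.Monic b
  reduced : ∀ b ∈ B, ∀ b' ∈ B, b ≠ b' → ∀ d ∈ b.support, ¬ m.degree b' ≤ d

end Groebner

/-! ### Parametric ideals: `μ` indexes the parameters `u`, `ξ` the variables `x` -/

section Parametric

variable {μ ξ K : Type*} [Field K]

/-- The specialization `K[u][x] → K[x]` of the parameters at the point `u₀`. -/
noncomputable def specialize (u₀ : μ → K) :
    MvPolynomial ξ (MvPolynomial μ K) →+* MvPolynomial ξ K :=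
  MvPolynomial.map (eval u₀)

/-- The specialization of `b` at `u₀`, divided by the value of the leading coefficient
of `b`. -/
noncomputable def monicSpecialize (m : MonomialOrder ξ) (u₀ : μ → K)
    (b : MvPolynomial ξ (MvPolynomial μ K)) : MvPolynomial ξ K :=
  C (eval u₀ (m.leadingCoeff b))⁻¹ * specialize u₀ b

/-- `b` has content `1` with respect to `x` over `K[u]`. -/
def HasContentOne (b : MvPolynomial ξ (MvPolynomial μ K)) : Prop :=
  ∀ d : MvPolynomial μ K, (∀ e : ξ →₀ ℕ, d ∣ b.coeff e) → IsUnit d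

/-- The pairs `(S i, B i)` form a Gröbner system of the parametric ideal `I`. -/
structure IsGroebnerSystem (m : MonomialOrder ξ)
    (I : Ideal (MvPolynomial ξ (MvPolynomial μ K))) {s : ℕ}
    (S : Fin s → Set (μ → K)) (B : Fin s → Set (MvPolynomial ξ (MvPolynomial μ K))) :
    Prop where
  constructible : ∀ i, IsConstructibleSet (S i)
  finite : ∀ i, (B i).Finite
  cover : ⋃ i, S i = Set.univ
  groebner : ∀ i, ∀ u₀ ∈ S i,
    IsGroebnerBasis m (I.map (specialize u₀)) (specialize u₀ '' B i)

/-- A Gröbner system whose segments partition the parameter space and whose bases have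
content `1`, have leading coefficients without zeros on the segment (so that the leading
monomials do not change), and specialize to the reduced Gröbner basis, up to making the
specialized polynomials monic. -/
structure IsReducedGroebnerSystem (m : MonomialOrder ξ)
    (I : Ideal (MvPolynomial ξ (MvPolynomial μ K))) {s : ℕ}
    (S : Fin s → Set (μ → K)) (B : Fin s → Set (MvPolynomial ξ (MvPolynomial μ K))) :
    Prop extends IsGroebnerSystem m I S B where
  nonempty : ∀ i, (S i).Nonempty
  disjoint : Pairwise fun i j => Disjoint (S i) (S j)
  contentOne : ∀ i, ∀ b ∈ B i, HasContentOne b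
  degree_injOn : ∀ i, Set.InjOn m.degree (B i)
  leadingCoeff_ne_zero : ∀ i, ∀ u₀ ∈ S i, ∀ b ∈ B i, eval u₀ (m.leadingCoeff b) ≠ 0
  reduced : ∀ i, ∀ u₀ ∈ S i,
    IsReducedGroebnerBasis m (I.map (specialize u₀)) (monicSpecialize m u₀ '' B i)

/-- A minimal comprehensive Gröbner system of `I`: a reduced one with the least possible
number of segments. -/
structure IsMCCGS (m : MonomialOrder ξ)
    (I : Ideal (MvPolynomial ξ (MvPolynomial μ K))) {s : ℕ}
    (S : Fin s → Set (μ → K)) (B : Fin s → Set (MvPolynomial ξ (MvPolynomial μ K))) :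
    Prop extends IsReducedGroebnerSystem m I S B where
  minimal : ∀ (s' : ℕ) (S' : Fin s' → Set (μ → K))
    (B' : Fin s' → Set (MvPolynomial ξ (MvPolynomial μ K))),
    IsReducedGroebnerSystem m I S' B' → s ≤ s'

/-- The basis `B` is `1`. Content-`1` polynomials are only determined up to a nonzero
constant factor, so `B` consists of one nonzero constant. -/
def IsBasisOne (B : Set (MvPolynomial ξ (MvPolynomial μ K))) : Prop :=
  ∃ c : K, c ≠ 0 ∧ B = {C (C c)}

end Parametric

/-! ### The ideal `(H, T z - 1)` with parameters `U` -/

section Rabinowitsch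

variable {σ K : Type*} [Field K]

open Classical in
/-- The embedding `K[X] → K[U][X \ U, z]`; the new variable `z` is `X none`. -/
noncomputable def toParametric (U : Set σ) :
    MvPolynomial σ K →ₐ[K] MvPolynomial (Option ↥Uᶜ) (MvPolynomial U K) :=
  aeval fun i => if h : i ∈ U then C (X ⟨i, h⟩) else X (some ⟨i, h⟩)

/-- The ideal `(H, T z - 1)` of `K[U][X \ U, z]`. -/
noncomputable def refutationIdeal (U : Set σ) (H : Ideal (MvPolynomial σ K))
    (T : MvPolynomial σ K) : Ideal (MvPolynomial (Option ↥Uᶜ) (MvPolynomial U K)) :=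
  H.map (toParametric U) ⊔ Ideal.span {toParametric U T * X none - 1}

end Rabinowitsch

end MCCGS

/-!
The components of `V(H)` are the zero loci of the minimal primes of `H`. As these are finitely
many, `T` vanishes on the independent ones if and only if `f T` vanishes on all of `V(H)` for some
nonzero `f ∈ K[U]`, the dependent components being killed by `f`. By Rabinowitsch's trick, modulo
`T z - 1` this puts a power of `f` into `I`, and `I ∩ K[U] ≠ (0)` makes the specialization `I_u` the
unit ideal at every `u` outside a hypersurface. Conversely a point of `V(H)` off `V(T)` over `u` is
a zero of `I_u`, so if `I_u` is the unit ideal wherever `f` does not vanish, `f T` vanishes on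
`V(H)`.

All of this concerns generic parameters `u`. For reduced Gröbner systems, the basis of a segment
is `1` if and only if `I_u` is the unit ideal at any one point `u` of the segment, and exactly one
segment is generic because a finite union of sets that are not Zariski dense is not Zariski dense,
while two nonempty open sets meet.
-/

namespace MCCGS

section MinimalPrimes

lemma exists_mul_mem_radical_iff {A R F : Type*} [CommRing A] [IsDomain A] [CommRing R]
    [FunLike F A R] [RingHomClass F A R] (φ : F) {H : Ideal R} (hH : H.minimalPrimes.Finite)
    {t : R} :
    (∃ a ≠ 0, φ a * t ∈ H.radical) ↔ ∀ P ∈ H.minimalPrimes, P.comap φ = ⊥ → t ∈ P := by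
  classical
  simp only [← Ideal.sInf_minimalPrimes, Ideal.mem_sInf]
  constructor
  · rintro ⟨a, ha, hat⟩ P hP hPφ
    refine (hP.1.1.mem_or_mem (hat hP)).resolve_left fun haP => ha ?_
    rwa [← Ideal.mem_comap, hPφ, Ideal.mem_bot] at haP
  · intro h
    have hfactor : ∀ P ∈ H.minimalPrimes, ∃ a ≠ 0, φ a * t ∈ P := by
      intro P hP
      by_cases hPφ : P.comap φ = ⊥
      · exact ⟨1, one_ne_zero, P.mul_mem_left _ (h P hP hPφ)⟩
      · obtain ⟨a, haP, ha⟩ := Submodule.exists_mem_ne_zero_of_ne_bot hPφ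
        exact ⟨a, ha, P.mul_mem_right _ haP⟩
    choose! a ha haP using hfactor
    refine ⟨∏ P ∈ hH.toFinset, a P,
      Finset.prod_ne_zero_iff.mpr fun P hP => ha P (hH.mem_toFinset.mp hP), fun P hP => ?_⟩
    rw [← Finset.mul_prod_erase _ _ (hH.mem_toFinset.mpr hP), map_mul, mul_right_comm]
    exact P.mul_mem_right _ (haP P hP)

end MinimalPrimes

section Components

variable {σ K : Type*} [Field K]

lemma isIrreducibleAlgebraicSet_iff {C : Set (σ → K)} :
    IsIrreducibleAlgebraicSet C ↔ IsAlgebraicSet C ∧ (vanishingIdeal K C).IsPrime := by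
  constructor
  · intro hC
    refine ⟨hC.isAlgebraicSet, (Ideal.ne_top_iff_one _).mpr fun h => ?_, fun {p q} hpq => ?_⟩
    · obtain ⟨x, hx⟩ := hC.nonempty
      simpa using h x hx
    · simpa [zeroLocus_span, Set.subset_def] using
        hC.subset_or_subset (Ideal.span {p}) (Ideal.span {q}) fun x hx => by
          simpa [zeroLocus_span] using hpq x hx
  · rintro ⟨halg, hprime⟩
    refine ⟨halg, Set.nonempty_iff_ne_empty.mpr ?_, fun I J hIJ => ?_⟩
    · rintro rfl
      exact hprime.ne_top vanishingIdeal_empty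
    · have hmul : I * J ≤ vanishingIdeal K C := Ideal.mul_le.mpr fun p hp q hq x hx => by
        rcases hIJ hx with h | h
        · rw [map_mul, h p hp, zero_mul]
        · rw [map_mul, h q hq, mul_zero]
      exact (hprime.mul_le.mp hmul).imp le_zeroLocus_iff_le_vanishingIdeal.mpr
        le_zeroLocus_iff_le_vanishingIdeal.mpr

variable [IsAlgClosed K] [Finite σ]

lemma isIrreducibleAlgebraicSet_zeroLocus (P : Ideal (MvPolynomial σ K)) [hP : P.IsPrime] :
    IsIrreducibleAlgebraicSet (zeroLocus K P) :=
  isIrreducibleAlgebraicSet_iff.mpr ⟨⟨P, rfl⟩, by rwa [IsPrime.vanishingIdeal_zeroLocus]⟩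

lemma isComponent_zeroLocus_iff {H : Ideal (MvPolynomial σ K)} {C : Set (σ → K)} :
    IsComponent (zeroLocus K H) C ↔ ∃ P ∈ H.minimalPrimes, zeroLocus K P = C := by
  constructor
  · rintro ⟨⟨hC, hCH⟩, hmax⟩
    have := (isIrreducibleAlgebraicSet_iff.mp hC).2
    obtain ⟨P, hP, hPC⟩ :=
      Ideal.exists_minimalPrimes_le (le_zeroLocus_iff_le_vanishingIdeal.mp hCH)
    have := hP.1.1
    have hCP : C ⊆ zeroLocus K P := le_zeroLocus_iff_le_vanishingIdeal.mpr hPC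
    exact ⟨P, hP, (hmax ⟨isIrreducibleAlgebraicSet_zeroLocus P, zeroLocus_anti_mono hP.1.2⟩
      hCP).antisymm hCP⟩
  · rintro ⟨P, hP, rfl⟩
    have := hP.1.1
    refine ⟨⟨isIrreducibleAlgebraicSet_zeroLocus P, zeroLocus_anti_mono hP.1.2⟩, ?_⟩
    rintro D ⟨hD, hDH⟩ hPD
    have hDP : vanishingIdeal K D ≤ P :=
      (vanishingIdeal_anti_mono hPD).trans (IsPrime.vanishingIdeal_zeroLocus P).le
    exact le_zeroLocus_iff_le_vanishingIdeal.mpr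
      (hP.2 ⟨(isIrreducibleAlgebraicSet_iff.mp hD).2,
        le_zeroLocus_iff_le_vanishingIdeal.mp hDH⟩ hDP)

lemma vanishesOnIndependentComponents_iff_forall_minimalPrimes {U : Set σ}
    {H : Ideal (MvPolynomial σ K)} {T : MvPolynomial σ K} :
    VanishesOnIndependentComponents U H T ↔
      ∀ P ∈ H.minimalPrimes, IndependentVars U P → T ∈ P := by
  have hvanish : ∀ P ∈ H.minimalPrimes, vanishingIdeal K (zeroLocus K P) = P := fun P hP =>
    have := hP.1.1
    IsPrime.vanishingIdeal_zeroLocus P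
  simp only [VanishesOnIndependentComponents, isComponent_zeroLocus_iff, forall_exists_index,
    and_imp, forall_apply_eq_imp_iff₂, ← aeval_eq_eval, ← mem_vanishingIdeal_iff]
  refine forall₂_congr fun P hP => ?_
  rw [hvanish P hP]

lemma vanishesOnIndependentComponents_iff_exists_mul_mem_radical {U : Set σ}
    {H : Ideal (MvPolynomial σ K)} {T : MvPolynomial σ K} :
    VanishesOnIndependentComponents U H T ↔
      ∃ f : MvPolynomial U K, f ≠ 0 ∧ rename (↑) f * T ∈ H.radical := by
  rw [vanishesOnIndependentComponents_iff_forall_minimalPrimes]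
  exact (exists_mul_mem_radical_iff _ H.finite_minimalPrimes_of_isNoetherianRing).symm

end Components

section ZariskiDense

variable {μ K : Type*} [Field K]

lemma ContainsOpen.mono {S S' : Set (μ → K)} (h : ContainsOpen S) (hS : S ⊆ S') :
    ContainsOpen S' :=
  let ⟨J, hJ, hJS⟩ := h
  ⟨J, hJ, hJS.trans hS⟩

lemma ContainsOpen.nonempty {S : Set (μ → K)} (h : ContainsOpen S) : S.Nonempty :=
  let ⟨_, hJ, hJS⟩ := h
  hJ.mono hJS

lemma exists_vanishingIdeal_eq_bot_of_iUnion {ι : Type*} [Finite ι] {S : ι → Set (μ → K)}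
    (h : vanishingIdeal K (⋃ i, S i) = ⊥) : ∃ i, vanishingIdeal K (S i) = ⊥ := by
  have := Fintype.ofFinite ι
  by_contra! hne
  choose g hgS hg using fun i => Submodule.exists_mem_ne_zero_of_ne_bot (hne i)
  have hprod : ∏ i, g i ∈ vanishingIdeal K (⋃ i, S i) := fun x hx => by
    obtain ⟨i, hi⟩ := Set.mem_iUnion.mp hx
    rw [map_prod]
    exact Finset.prod_eq_zero (Finset.mem_univ i) (hgS i x hi)
  rw [h, Ideal.mem_bot] at hprod
  exact Finset.prod_ne_zero_iff.mpr (fun i _ => hg i) hprod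

lemma IsConstructibleSet.containsOpen_of_vanishingIdeal_eq_bot {S : Set (μ → K)}
    (hS : IsConstructibleSet S) (hdense : vanishingIdeal K S = ⊥) : ContainsOpen S := by
  obtain ⟨n, a, b, rfl⟩ := hS
  obtain ⟨j, hj⟩ := exists_vanishingIdeal_eq_bot_of_iUnion hdense
  have ha : a j = ⊥ := le_bot_iff.mp <|
    hj ▸ le_zeroLocus_iff_le_vanishingIdeal.mp Set.sdiff_subset
  have hpiece : zeroLocus K (a j) \ zeroLocus K (b j) = (zeroLocus K (b j))ᶜ := by
    rw [ha, zeroLocus_bot, Set.top_eq_univ, Set.compl_eq_univ_sdiff]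
  rw [hpiece] at hj
  refine ⟨b j, Set.nonempty_iff_ne_empty.mpr fun hempty => ?_,
    hpiece ▸ Set.subset_iUnion (fun j => zeroLocus K (a j) \ zeroLocus K (b j)) j⟩
  rw [hempty, vanishingIdeal_empty] at hj
  exact top_ne_bot hj

variable [Infinite K]

lemma vanishingIdeal_univ : vanishingIdeal K (Set.univ : Set (μ → K)) = ⊥ :=
  le_bot_iff.mp fun p hp => MvPolynomial.funext fun x => by
    simpa [aeval_eq_eval] using hp x (Set.mem_univ x)

lemma containsOpen_iff_exists_eval {S : Set (μ → K)} :
    ContainsOpen S ↔ ∃ g : MvPolynomial μ K, g ≠ 0 ∧ ∀ x, eval x g ≠ 0 → x ∈ S := by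
  constructor
  · rintro ⟨J, ⟨x, hx⟩, hJS⟩
    simp only [Set.mem_compl_iff, mem_zeroLocus_iff, not_forall] at hx
    obtain ⟨g, hgJ, hgx⟩ := hx
    refine ⟨g, ?_, fun y hy => hJS fun hyJ => hy (hyJ g hgJ)⟩
    rintro rfl
    exact hgx (map_zero _)
  · rintro ⟨g, hg, hgS⟩
    have hcompl : (zeroLocus K (Ideal.span {g}))ᶜ = {x | eval x g ≠ 0} := by
      ext x
      simp [zeroLocus_span, aeval_eq_eval]
    refine ⟨Ideal.span {g}, ?_, hcompl ▸ hgS⟩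
    rw [hcompl]
    by_contra! hempty
    refine hg (MvPolynomial.funext fun x => ?_)
    simpa using Set.eq_empty_iff_forall_notMem.mp hempty x

lemma ContainsOpen.inter {S S' : Set (μ → K)} (h : ContainsOpen S) (h' : ContainsOpen S') :
    ContainsOpen (S ∩ S') := by
  obtain ⟨g, hg, hgS⟩ := containsOpen_iff_exists_eval.mp h
  obtain ⟨g', hg', hgS'⟩ := containsOpen_iff_exists_eval.mp h'
  refine containsOpen_iff_exists_eval.mpr ⟨g * g', mul_ne_zero hg hg', fun x hx => ?_⟩
  rw [map_mul, mul_ne_zero_iff] at hx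
  exact ⟨hgS x hx.1, hgS' x hx.2⟩

lemma existsUnique_containsOpen {ι : Type*} [Finite ι] {S : ι → Set (μ → K)}
    (hS : ∀ i, IsConstructibleSet (S i)) (hcover : ⋃ i, S i = Set.univ)
    (hdisj : Pairwise fun i j => Disjoint (S i) (S j)) : ∃! i, ContainsOpen (S i) := by
  obtain ⟨i, hdense⟩ := exists_vanishingIdeal_eq_bot_of_iUnion (hcover ▸ vanishingIdeal_univ)
  have hi := (hS i).containsOpen_of_vanishingIdeal_eq_bot hdense
  refine ⟨i, hi, fun j hj => ?_⟩
  by_contra hne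
  exact Set.not_disjoint_iff_nonempty_inter.mpr (hj.inter hi).nonempty (hdisj hne)

end ZariskiDense

section Groebner

variable {ξ K : Type*} [Field K]

lemma IsReducedGroebnerBasis.eq_singleton_one {m : MonomialOrder ξ}
    {B : Set (MvPolynomial ξ K)} (hB : IsReducedGroebnerBasis m ⊤ B) : B = {1} := by
  obtain ⟨b, hb, -, hdeg⟩ := hB.isGroebnerBasis.2 1 Submodule.mem_top one_ne_zero
  have hdeg_zero : m.degree b = 0 := le_bot_iff.mp (hdeg.trans m.degree_one.le)
  have hb_one : b = 1 := by
    rw [m.eq_C_of_degree_eq_zero hdeg_zero, (hB.monic b hb).leadingCoeff_eq_one, C_1]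
  refine Set.eq_singleton_iff_unique_mem.mpr ⟨hb_one ▸ hb, fun b' hb' => ?_⟩
  by_contra hne
  exact hB.reduced b' hb' b hb (hb_one ▸ hne) _ (m.degree_mem_support (hB.monic b' hb').ne_zero)
    (hdeg_zero ▸ bot_le)

end Groebner

section Parametric

variable {μ ξ K : Type*} [Field K]

lemma degree_monicSpecialize {m : MonomialOrder ξ} {u₀ : μ → K}
    {b : MvPolynomial ξ (MvPolynomial μ K)} (hb : eval u₀ (m.leadingCoeff b) ≠ 0) :
    m.degree (monicSpecialize m u₀ b) = m.degree b := by
  have hcoeff (d : ξ →₀ ℕ) : (monicSpecialize m u₀ b).coeff d =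
      (eval u₀ (m.leadingCoeff b))⁻¹ * eval u₀ (b.coeff d) := by
    rw [monicSpecialize, specialize, coeff_C_mul, coeff_map]
  apply m.toSyn.injective
  refine le_antisymm (m.degree_le_iff.mpr fun d hd => m.le_degree ?_) (m.le_degree ?_)
  · rw [mem_support_iff, hcoeff] at hd
    exact mem_support_iff.mpr fun h => hd (by rw [h, map_zero, mul_zero])
  · rw [mem_support_iff, hcoeff]
    exact mul_ne_zero (inv_ne_zero hb) hb

lemma HasContentOne.isUnit_of_C {a : MvPolynomial μ K}
    (h : HasContentOne (C a : MvPolynomial ξ (MvPolynomial μ K))) : IsUnit a := by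
  classical
  refine h a fun e => ?_
  rw [coeff_C]
  split_ifs
  · exact dvd_rfl
  · exact dvd_zero a

lemma HasContentOne.exists_eq_C_C {m : MonomialOrder ξ} {b : MvPolynomial ξ (MvPolynomial μ K)}
    (h : HasContentOne b) (hdeg : m.degree b = 0) : ∃ c : K, c ≠ 0 ∧ b = C (C c) := by
  have hb := m.eq_C_of_degree_eq_zero hdeg
  obtain ⟨c, hc, hcb⟩ := MvPolynomial.isUnit_iff_eq_C_of_isReduced.mp (hb ▸ h).isUnit_of_C
  exact ⟨c, hc.ne_zero, hcb ▸ hb⟩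

/-- The inconsistency locus of the parametric ideal `I`: the parameters at which `I` specializes to
the unit ideal. Over an algebraically closed field and for finitely many variables, the specialized
system has no solution exactly at these parameters. -/
def inconsistentLocus (I : Ideal (MvPolynomial ξ (MvPolynomial μ K))) : Set (μ → K) :=
  {u | I.map (specialize u) = ⊤}

lemma mem_inconsistentLocus_of_C_mem {I : Ideal (MvPolynomial ξ (MvPolynomial μ K))}
    {f : MvPolynomial μ K} (hf : C f ∈ I) {u : μ → K} (hu : eval u f ≠ 0) :
    u ∈ inconsistentLocus I := by
  have hmem := Ideal.mem_map_of_mem (specialize u) hf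
  rw [specialize, map_C] at hmem
  exact Ideal.eq_top_of_isUnit_mem _ hmem (hu.isUnit.map C)

lemma containsOpen_inconsistentLocus [Infinite K]
    {I : Ideal (MvPolynomial ξ (MvPolynomial μ K))} (hI : I.comap C ≠ ⊥) :
    ContainsOpen (inconsistentLocus I) :=
  let ⟨f, hfI, hf⟩ := Submodule.exists_mem_ne_zero_of_ne_bot hI
  containsOpen_iff_exists_eval.mpr ⟨f, hf, fun _ => mem_inconsistentLocus_of_C_mem hfI⟩

variable {m : MonomialOrder ξ} {I : Ideal (MvPolynomial ξ (MvPolynomial μ K))} {s : ℕ}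
  {S : Fin s → Set (μ → K)} {B : Fin s → Set (MvPolynomial ξ (MvPolynomial μ K))} {i : Fin s}

lemma IsGroebnerSystem.mem_inconsistentLocus (h : IsGroebnerSystem m I S B)
    (hB : IsBasisOne (B i)) {u : μ → K} (hu : u ∈ S i) : u ∈ inconsistentLocus I := by
  obtain ⟨c, hc, hBi⟩ := hB
  have hmem : specialize u (C (C c)) ∈ I.map (specialize u) :=
    (h.groebner i u hu).1 (Set.mem_image_of_mem _ (hBi ▸ Set.mem_singleton _))
  rw [specialize, map_C, eval_C] at hmem
  exact Ideal.eq_top_of_isUnit_mem _ hmem (hc.isUnit.map C)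

lemma IsReducedGroebnerSystem.isBasisOne (h : IsReducedGroebnerSystem m I S B) {u : μ → K}
    (hu : u ∈ S i) (huI : u ∈ inconsistentLocus I) : IsBasisOne (B i) := by
  have himage : monicSpecialize m u '' B i = {1} :=
    IsReducedGroebnerBasis.eq_singleton_one (huI ▸ h.reduced i u hu)
  have hdeg : ∀ b ∈ B i, m.degree b = 0 := fun b hb => by
    have hb_one : monicSpecialize m u b = 1 := himage.subset (Set.mem_image_of_mem _ hb)
    rw [← degree_monicSpecialize (h.leadingCoeff_ne_zero i u hu b hb), hb_one, m.degree_one]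
  obtain ⟨b, hb⟩ : (B i).Nonempty :=
    Set.image_nonempty.mp (himage ▸ Set.singleton_nonempty 1)
  obtain ⟨c, hc, rfl⟩ := (h.contentOne i b hb).exists_eq_C_C (hdeg b hb)
  exact ⟨c, hc, Set.eq_singleton_iff_unique_mem.mpr
    ⟨hb, fun b' hb' => h.degree_injOn i hb' hb ((hdeg b' hb').trans (hdeg _ hb).symm)⟩⟩

lemma IsReducedGroebnerSystem.isBasisOne_iff_containsOpen [Infinite K]
    (h : IsReducedGroebnerSystem m I S B) (hi : ContainsOpen (S i)) :
    IsBasisOne (B i) ↔ ContainsOpen (inconsistentLocus I) := by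
  refine ⟨fun hB => hi.mono fun u hu => h.mem_inconsistentLocus hB hu, fun hI => ?_⟩
  obtain ⟨u, hu, huI⟩ := (hi.inter hI).nonempty
  exact h.isBasisOne hu huI

end Parametric

section Rabinowitsch

variable {σ K : Type*} [Field K] {U : Set σ} {H : Ideal (MvPolynomial σ K)} {T : MvPolynomial σ K}

lemma toParametric_rename (f : MvPolynomial U K) : toParametric U (rename (↑) f) = C f := by
  induction f using MvPolynomial.induction_on with
  | C a => simp [MvPolynomial.algebraMap_eq]
  | add p q hp hq => simp [hp, hq]
  | mul_X p i hp =>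
    rw [map_mul, map_mul, hp]
    simp [toParametric]

lemma C_mem_radical_refutationIdeal {f : MvPolynomial U K} (h : rename (↑) f * T ∈ H.radical) :
    C f ∈ (refutationIdeal U H T).radical := by
  have hfT : C f * toParametric U T ∈ (refutationIdeal U H T).radical := by
    have hmap := Ideal.map_radical_le (toParametric U) (Ideal.mem_map_of_mem _ h)
    rw [map_mul, toParametric_rename] at hmap
    exact Ideal.radical_mono le_sup_left hmap
  have hTz : toParametric U T * X none - 1 ∈ (refutationIdeal U H T).radical :=
    Ideal.le_radical (Ideal.mem_sup_right (Ideal.mem_span_singleton_self _))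
  have heq : C f = C f * toParametric U T * X none - C f * (toParametric U T * X none - 1) := by
    ring
  rw [heq]
  exact sub_mem (Ideal.mul_mem_right _ _ hfT) (Ideal.mul_mem_left _ _ hTz)

/-- The point with the coordinates of `x` outside `U` and the coordinate `z` for the new variable:
a point of the fiber over `x|U` of the projection to the parameter space. -/
def fiberPoint (U : Set σ) (x : σ → K) (z : K) : Option ↥Uᶜ → K
  | none => z
  | some i => x i

lemma eval_fiberPoint_specialize_toParametric (x : σ → K) (z : K) (p : MvPolynomial σ K) :
    eval (fiberPoint U x z) (specialize (fun i : U => x i) (toParametric U p)) = eval x p := by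
  induction p using MvPolynomial.induction_on with
  | C a => simp [specialize, toParametric]
  | add p q hp hq => simp [hp, hq]
  | mul_X p i hp =>
    have hX : eval (fiberPoint U x z) (specialize (fun i : U => x i) (toParametric U (X i))) =
        x i := by
      by_cases hi : i ∈ U <;> simp [specialize, toParametric, hi, fiberPoint]
    rw [map_mul, map_mul, map_mul, map_mul, hp, hX, eval_X]

lemma notMem_inconsistentLocus_refutationIdeal {x : σ → K} (hx : x ∈ zeroLocus K H)
    (hT : eval x T ≠ 0) : (fun i : U => x i) ∉ inconsistentLocus (refutationIdeal U H T) := by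
  set φ := (eval (fiberPoint U x (eval x T)⁻¹)).comp (specialize fun i : U => x i) with hφ
  have hle : refutationIdeal U H T ≤ RingHom.ker φ := by
    rw [refutationIdeal, sup_le_iff, Ideal.map_le_iff_le_comap, Ideal.span_singleton_le_iff_mem]
    constructor
    · intro p hp
      rw [Ideal.mem_comap, RingHom.mem_ker, hφ, RingHom.comp_apply,
        eval_fiberPoint_specialize_toParametric]
      exact hx p hp
    · rw [RingHom.mem_ker, map_sub, map_mul, hφ, RingHom.comp_apply, RingHom.comp_apply,
        eval_fiberPoint_specialize_toParametric]
      simp [specialize, fiberPoint, hT]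
  rw [← RingHom.comap_ker, ← Ideal.map_le_iff_le_comap] at hle
  exact ne_top_of_le_ne_top (RingHom.ker_ne_top _) hle

variable [IsAlgClosed K] [Finite σ]

lemma mul_mem_radical_of_forall_mem_inconsistentLocus {f : MvPolynomial U K}
    (h : ∀ u, eval u f ≠ 0 → u ∈ inconsistentLocus (refutationIdeal U H T)) :
    rename (↑) f * T ∈ H.radical := by
  rw [← vanishingIdeal_zeroLocus_eq_radical (K := K)]
  intro x hx
  rw [aeval_eq_eval, map_mul, eval_rename, mul_eq_zero]
  by_contra! hne
  exact notMem_inconsistentLocus_refutationIdeal hx hne.2 (h _ hne.1)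

lemma vanishesOnIndependentComponents_tfae (U : Set σ) (H : Ideal (MvPolynomial σ K))
    (T : MvPolynomial σ K) : List.TFAE [
      VanishesOnIndependentComponents U H T,
      (refutationIdeal U H T).comap
        (C : MvPolynomial U K →+* MvPolynomial (Option ↥Uᶜ) (MvPolynomial U K)) ≠ ⊥,
      ContainsOpen (inconsistentLocus (refutationIdeal U H T))] := by
  rw [vanishesOnIndependentComponents_iff_exists_mul_mem_radical]
  tfae_have 1 → 2 := by
    rintro ⟨f, hf, hfT⟩
    obtain ⟨n, hn⟩ := C_mem_radical_refutationIdeal hfT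
    rw [← map_pow] at hn
    exact (Submodule.ne_bot_iff _).mpr ⟨f ^ n, hn, pow_ne_zero n hf⟩
  tfae_have 2 → 3 := containsOpen_inconsistentLocus
  tfae_have 3 → 1 := fun h =>
    let ⟨f, hf, hfI⟩ := containsOpen_iff_exists_eval.mp h
    ⟨f, hf, mul_mem_radical_of_forall_mem_inconsistentLocus hfI⟩
  tfae_finish

end Rabinowitsch

end MCCGS

theorem proposition6_general {K σ : Type*} [Field K] [IsAlgClosed K] [Finite σ]
    (H : Ideal (MvPolynomial σ K)) (T : MvPolynomial σ K) (U : Set σ)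
    (m : MonomialOrder (Option ↥Uᶜ)) :
    (MCCGS.VanishesOnIndependentComponents U H T ↔
      (MCCGS.refutationIdeal U H T).comap
        (C : MvPolynomial U K →+* MvPolynomial (Option ↥Uᶜ) (MvPolynomial U K)) ≠ ⊥) ∧
    ∀ (s : ℕ) (S : Fin s → Set (U → K))
      (B : Fin s → Set (MvPolynomial (Option ↥Uᶜ) (MvPolynomial U K))),
      MCCGS.IsReducedGroebnerSystem m (MCCGS.refutationIdeal U H T) S B →
        (∃! i, MCCGS.ContainsOpen (S i)) ∧
        ∀ i, MCCGS.ContainsOpen (S i) →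
          (MCCGS.VanishesOnIndependentComponents U H T ↔ MCCGS.IsBasisOne (B i)) := by
  have htfae := MCCGS.vanishesOnIndependentComponents_tfae U H T
  exact ⟨htfae.out 0 1, fun s S B hB =>
    ⟨MCCGS.existsUnique_containsOpen hB.constructible hB.cover hB.disjoint, fun i hi =>
      (htfae.out 0 2).trans (hB.isBasisOne_iff_containsOpen hi).symm⟩⟩

theorem proposition6 {K σ : Type*} [Field K] [IsAlgClosed K] [Finite σ]
    (H : Ideal (MvPolynomial σ K)) (T : MvPolynomial σ K)
    (U : Set σ) (hU : MCCGS.IndependentVars U H)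
    (m : MonomialOrder (Option ↥Uᶜ)) :
    (MCCGS.VanishesOnIndependentComponents U H T ↔
      (MCCGS.refutationIdeal U H T).comap
        (C : MvPolynomial U K →+* MvPolynomial (Option ↥Uᶜ) (MvPolynomial U K)) ≠ ⊥) ∧
    ∀ (s : ℕ) (S : Fin s → Set (U → K))
      (B : Fin s → Set (MvPolynomial (Option ↥Uᶜ) (MvPolynomial U K))),
      MCCGS.IsMCCGS m (MCCGS.refutationIdeal U H T) S B →
        (∃! i, MCCGS.ContainsOpen (S i)) ∧
        ∀ i, MCCGS.ContainsOpen (S i) →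
          (MCCGS.VanishesOnIndependentComponents U H T ↔ MCCGS.IsBasisOne (B i)) := by
  have ⟨hcomap, hsystem⟩ := proposition6_general H T U m
  exact ⟨hcomap, fun s S B hB => hsystem s S B hB.toIsReducedGroebnerSystem⟩
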